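/- Let $n\ge 2$ be an integer, let $\ell>3n+2$ be real and let $A$ be a real constant. For $L\geq 2$ put $\mathbb Z_L^n=(\mathbb Z/L)^n=\{k/L:\ k\in\mathbb Z^n\}\subset\mathbb R^n$. For $K\in\mathbb Z_L^n$ write $\langle K\rangle=\sqrt{1+|K|^2}$ with $|\cdot|$ the Euclidean norm, and for $\mu\in\mathbb R$ let $$\mathcal R_\mu(K)=\{(K_1,K_2,K_3)\in(\mathbb Z_L^n)^3:\ K_1-K_2+K_3-K=0,\ |K_1|^2-|K_2|^2+|K_3|^2-|K|^2=\mu\}.$$ Then there is a constant $C$, depending only on $n$, $\ell$ and $A$, such that for every real $L\ge 2$ and all complex sequences $(a_K)$, $(b_K)$, $(c_K)$ indexed by $K\in\mathbb Z_L^n$ with $$|a_K|+|b_K|+|c_K|\le A\,\langle K\rangle^{-\ell}\qquad\text{for all }K\in\mathbb Z_L^n,$$ the sum below converges absolutely for every $K\in\mathbb Z_L^n$ and $\mu\in\mathbb R$, and $$\sup_{K\in\mathbb Z_L^n,\ \mu\in\mathbb R}\ \langle K\rangle^{\ell}\,\Bigl|\sum_{(K_1,K_2,K_3)\in\mathcal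 R_\mu(K)}a_{K_1}b_{K_2}c_{K_3}\Bigr|\ \le\ C\cdot\begin{cases}L^{2n-2}&\text{if } n>2,\\ L^2\log L&\text{if } n=2.\end{cases}$$ -/

import Mathlib

noncomputable section

/-- The lattice `ℤ_L^n = (ℤ / L)^n` inside Euclidean space `ℝ^n`. -/
def scaledLattice (n : ℕ) (L : ℝ) : Set (EuclideanSpace ℝ (Fin n)) :=
  {K | ∃ k : Fin n → ℤ, ∀ i, K i = (k i : ℝ) / L}

/-- The Japanese bracket `⟨K⟩ = √(1 + |K|²)`, with the Euclidean norm. -/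
def jbracket {n : ℕ} (K : EuclideanSpace ℝ (Fin n)) : ℝ :=
  Real.sqrt (1 + ‖K‖ ^ 2)

/-- `𝓢₃(K) = K₁ - K₂ + K₃ - K`. -/
def momentum3 {n : ℕ} (K K₁ K₂ K₃ : EuclideanSpace ℝ (Fin n)) : EuclideanSpace ℝ (Fin n) :=
  K₁ - K₂ + K₃ - K

/-- `Ω₃(K) = |K₁|² - |K₂|² + |K₃|² - |K|²`. -/
def resonance3 {n : ℕ} (K K₁ K₂ K₃ : EuclideanSpace ℝ (Fin n)) : ℝ :=
  ‖K₁‖ ^ 2 - ‖K₂‖ ^ 2 + ‖K₃‖ ^ 2 - ‖K‖ ^ 2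

/-- The set `𝓡_μ(K)` of triples `(K₁, K₂, K₃)` in `(ℤ_L^n)³` with `𝓢₃(K) = 0` and `Ω₃(K) = μ`. -/
def resonantSet {n : ℕ} {L : ℝ} (μ : ℝ) (K : scaledLattice n L) :
    Set (scaledLattice n L × scaledLattice n L × scaledLattice n L) :=
  {p | momentum3 (K : EuclideanSpace ℝ (Fin n)) p.1 p.2.1 p.2.2 = 0 ∧
    resonance3 (K : EuclideanSpace ℝ (Fin n)) p.1 p.2.1 p.2.2 = μ}

/-- The size of the resonant sum: `L² log L` if `n = 2`, and `L^(2n-2)` if `n > 2`.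
It is used only for `n ≥ 2`. -/
def resonantRate (n : ℕ) (L : ℝ) : ℝ :=
  if n = 2 then L ^ 2 * Real.log L else L ^ (2 * n - 2)

end

/-! Put X = K₁ - K and Y = K₃ - K. The momentum relation gives K₂ = K + X + Y, and the resonance
function becomes -2 X·Y (`resonance3_eq`). After scaling by L, the problem is to count pairs of
integer vectors x, y with x·y = m, weighted by decay and uniformly in m.

Count in two cubes of side N = ⌈L⌉ placed anywhere (`exists_card_pairs_le`). For x ≠ 0 with
primitive part w, y lies on a hyperplane with normal w, which holds O(N^(n-2) + N^(n-1)/|w|) points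
of the cube (`card_hyperplane_le`). Summing over x requires ∑ 1/|w| (`sum_inv_primitivePart_le`). A
given w with |w| < N occurs for O(N/|w|) values of x, so the essential quantity is ∑ 1/|w|² over |w|
< N: it is O(log N) if n = 2 and O(N^(n-2)) if n > 2. This is the source of the logarithm.

For the weights, ⟨K⟩^ℓ is absorbed by the largest of the three brackets. The other two give decay of
order ℓ/2 > n in each of two variables, each a translate of X or Y (`jbracket_rpow_mul_le`). Such
weights are summable over cells of side N, and the cube count applies to each pair of cells
(`exists_sum_boxWeight_le`). -/

/-! ### Lattice points on hyperplanes with primitive normal. -/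

/-- Integers in an interval of length `N` that are congruent modulo `e` number at most `1 + N / e`. -/
theorem card_le_of_dvd_sub {S : Finset ℤ} {a : ℤ} {N e : ℕ} (he : 0 < e)
    (hS : ∀ t ∈ S, a ≤ t ∧ t < a + N) (hd : ∀ t ∈ S, ∀ t' ∈ S, (e : ℤ) ∣ t - t') :
    (S.card : ℝ) ≤ 1 + N / e := by
  have he' : (0 : ℤ) < e := by exact_mod_cast he
  have hcard : S.card ≤ (Finset.Icc 0 (N / e)).card := by
    refine Finset.card_le_card_of_injOn (fun t => ((t - a) / e).toNat) ?_ ?_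
    · intro t ht
      have h := hS t ht
      simp only [Finset.coe_Icc, Set.mem_Icc, zero_le, true_and]
      have h1 : (t - a) / e ≤ (N : ℤ) / e := Int.ediv_le_ediv he' (by omega)
      have h2 : ((N / e : ℕ) : ℤ) = (N : ℤ) / e := by push_cast; rfl
      exact Int.toNat_le.2 (h1.trans_eq h2.symm)
    · intro t ht t' ht' hE
      have h := hS t ht
      have h' := hS t' ht'
      have h0 : 0 ≤ (t - a) / e := Int.ediv_nonneg (by omega) he'.le
      have h0' : 0 ≤ (t' - a) / e := Int.ediv_nonneg (by omega) he'.le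
      have hq : (t - a) / e = (t' - a) / e := by
        simp only at hE
        omega
      have hm : (t - a) % e = (t' - a) % e :=
        Int.modEq_iff_dvd.2 (by simpa using hd t' ht' t ht)
      have e1 := Int.emod_add_mul_ediv (t - a) e
      have e2 := Int.emod_add_mul_ediv (t' - a) e
      rw [hq, hm] at e1
      linarith
  simp only [Nat.card_Icc, tsub_zero] at hcard
  have h3 : ((N / e : ℕ) : ℝ) ≤ (N : ℝ) / e := Nat.cast_div_le
  have h4 : (S.card : ℝ) ≤ ((N / e : ℕ) : ℝ) + 1 := by exact_mod_cast hcard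
  linarith

/-- The cardinality of a set is at most that of its image times a bound on the fibres. -/
theorem card_le_mul_card_image_real {α β : Type*} [DecidableEq β] (S : Finset α) (f : α → β)
    (B : ℝ) (hB : ∀ b ∈ S.image f, ((S.filter (fun a => f a = b)).card : ℝ) ≤ B) :
    (S.card : ℝ) ≤ (S.image f).card * B := by
  rw [Finset.card_eq_sum_card_image f S]
  push_cast
  calc _ ≤ ∑ b ∈ S.image f, B := Finset.sum_le_sum hB
    _ = _ := by simp

/-- The number of solutions of a primitive linear congruence in a cube. -/
theorem card_congruence_mul_le {N : ℕ} (hN : 0 < N) : ∀ (r : ℕ) (w a : Fin r → ℤ) (g : ℕ) (c : ℤ)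
    (S : Finset (Fin r → ℤ)), 0 < g →
    (∀ d : ℕ, d ∣ g → (∀ i, (d : ℤ) ∣ w i) → d = 1) →
    (∀ y ∈ S, ∀ i, a i ≤ y i ∧ y i < a i + N) →
    (∀ y ∈ S, (g : ℤ) ∣ ∑ i, w i * y i - c) →
    (S.card : ℝ) * N ≤ 3 ^ r * ((N : ℝ) ^ r + (N : ℝ) ^ (r + 1) / g) := by
  intro r
  induction r with
  | zero =>
    intro w a g c S hg hp _ _
    -- With no coordinates, primitivity forces g = 1. The factor N in the bound avoids the exponent
    -- r - 1 in this case.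
    have h1 : g = 1 := hp g dvd_rfl (fun i => i.elim0)
    have h2 : S.card ≤ 1 := Finset.card_le_one_of_subsingleton S
    have h3 : (S.card : ℝ) ≤ 1 := by exact_mod_cast h2
    have h4 : (0 : ℝ) ≤ N := by positivity
    subst h1
    simp
    nlinarith
  | succ r ih =>
    intro w a g c S hg hp hbox hS
    -- Write g = h e with h = gcd(g, w 0). The tail solves a congruence modulo h, still primitive
    -- since h divides w 0; for a fixed tail, y 0 is determined modulo e.
    obtain ⟨h, hh⟩ : ∃ h : ℕ, h = Int.gcd g (w 0) := ⟨_, rfl⟩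
    have hhg : h ∣ g := by
      rw [hh]
      exact Int.natCast_dvd_natCast.1 (Int.gcd_dvd_left ..)
    have hhw : (h : ℤ) ∣ w 0 := by
      rw [hh]
      exact Int.gcd_dvd_right ..
    have hpos : 0 < h := Nat.pos_of_dvd_of_pos hhg hg
    obtain ⟨e, rfl⟩ := hhg
    have hepos : 0 < e := Nat.pos_of_mul_pos_left hg
    obtain ⟨v, hv⟩ := hhw
    have hcop : IsCoprime (e : ℤ) v := by
      rw [Int.isCoprime_iff_gcd_eq_one]
      have : (h : ℕ) = h * Int.gcd e v := by
        conv_lhs => rw [hh, hv]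
        push_cast
        rw [Int.gcd_mul_left]
        simp
      exact Nat.eq_of_mul_eq_mul_left hpos (by omega)
    have hrec := ih (Fin.tail w) (Fin.tail a) h c (S.image Fin.tail) hpos
      (fun d hd hdw => hp d (hd.mul_right e) (fun i => by
        refine Fin.cases ?_ (fun j => hdw j) i
        exact (Int.natCast_dvd_natCast.2 hd).trans ⟨v, hv⟩))
      (by
        intro y hy i
        obtain ⟨z, hz, rfl⟩ := Finset.mem_image.1 hy
        exact hbox z hz i.succ)
      (by
        intro y hy
        obtain ⟨z, hz, rfl⟩ := Finset.mem_image.1 hy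
        have h1 : (h : ℤ) ∣ ∑ i, w i * z i - c :=
          (Int.natCast_dvd_natCast.2 (Dvd.intro _ rfl)).trans (hS z hz)
        rw [Fin.sum_univ_succ] at h1
        have h2 : (h : ℤ) ∣ w 0 * z 0 := (Dvd.intro _ hv.symm).mul_right _
        have h3 := dvd_sub h1 h2
        rwa [add_sub_assoc, add_sub_cancel_left] at h3)
    have hfib : (S.card : ℝ) ≤ (S.image Fin.tail).card * (1 + (N : ℝ) / e) := by
      refine card_le_mul_card_image_real S Fin.tail _ (fun z _ => ?_)
      have hinj : Set.InjOn (fun y : Fin (r + 1) → ℤ => y 0)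
          (S.filter (fun y => Fin.tail y = z)) := by
        intro y hy y' hy' h0
        simp only [Finset.coe_filter, Set.mem_ofPred_eq] at hy hy'
        rw [← Fin.cons_self_tail y, ← Fin.cons_self_tail y', hy.2, hy'.2]
        simp only at h0
        rw [h0]
      rw [← Finset.card_image_of_injOn hinj]
      refine card_le_of_dvd_sub (a := a 0) hepos ?_ ?_
      · intro t ht
        obtain ⟨y, hy, rfl⟩ := Finset.mem_image.1 ht
        exact hbox y (Finset.mem_filter.1 hy).1 0
      · intro t ht t' ht'
        obtain ⟨y, hy, rfl⟩ := Finset.mem_image.1 ht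
        obtain ⟨y', hy', rfl⟩ := Finset.mem_image.1 ht'
        obtain ⟨hy, hyz⟩ := Finset.mem_filter.1 hy
        obtain ⟨hy', hyz'⟩ := Finset.mem_filter.1 hy'
        have h1 := dvd_sub (hS y hy) (hS y' hy')
        rw [Fin.sum_univ_succ, Fin.sum_univ_succ] at h1
        have h2 : ∑ i : Fin r, w i.succ * y i.succ = ∑ i : Fin r, w i.succ * y' i.succ := by
          refine Finset.sum_congr rfl (fun i _ => ?_)
          have := congrFun (hyz.trans hyz'.symm) i
          simp only [Fin.tail] at this
          rw [this]
        rw [h2, hv] at h1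
        have h3 : (h : ℤ) * e ∣ h * (v * (y 0 - y' 0)) := by
          obtain ⟨u, hu⟩ := h1
          push_cast at hu
          exact ⟨u, by linear_combination hu⟩
        exact hcop.dvd_of_dvd_mul_left
          (Int.dvd_of_mul_dvd_mul_left (by exact_mod_cast hpos.ne') h3)
    have hN1 : (1 : ℝ) ≤ N := by exact_mod_cast hN
    have hh1 : (1 : ℝ) ≤ h := by exact_mod_cast hpos
    have he1 : (1 : ℝ) ≤ e := by exact_mod_cast hepos
    have hP : (1 : ℝ) ≤ (N : ℝ) ^ r := one_le_pow₀ hN1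
    calc (S.card : ℝ) * N ≤ ((S.image Fin.tail).card * N) * (1 + (N : ℝ) / e) := by
          nlinarith
      _ ≤ (3 ^ r * ((N : ℝ) ^ r + (N : ℝ) ^ (r + 1) / h)) * (1 + (N : ℝ) / e) := by
          gcongr
      _ = 3 ^ r * ((N : ℝ) ^ r + (N : ℝ) ^ (r + 1) / h + (N : ℝ) ^ (r + 1) / e +
            (N : ℝ) ^ (r + 2) / (h * e)) := by
          field_simp
          ring
      _ ≤ 3 ^ r * ((N : ℝ) ^ (r + 1) + (N : ℝ) ^ (r + 1) + (N : ℝ) ^ (r + 1) +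
            3 * ((N : ℝ) ^ (r + 2) / (h * e))) := by
          have h5 : (0 : ℝ) ≤ (N : ℝ) ^ (r + 2) / (h * e) := by positivity
          gcongr ?_ * (?_ + ?_ + ?_ + ?_)
          · exact pow_le_pow_right₀ hN1 (by omega)
          · exact div_le_self (by positivity) hh1
          · exact div_le_self (by positivity) he1
          · linarith
      _ = 3 ^ (r + 1) * ((N : ℝ) ^ (r + 1) + (N : ℝ) ^ (r + 1 + 1) / ((h * e : ℕ) : ℝ)) := by
          push_cast
          ring

/-- The number of lattice points of a cube on a hyperplane with primitive normal vector. -/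
theorem card_hyperplane_le {N : ℕ} (hN : 0 < N) {r : ℕ} (w a : Fin (r + 2) → ℤ) (c : ℤ)
    (i₀ : Fin (r + 2)) (hi₀ : w i₀ ≠ 0) (S : Finset (Fin (r + 2) → ℤ))
    (hp : ∀ d : ℕ, (∀ i, (d : ℤ) ∣ w i) → d = 1)
    (hbox : ∀ y ∈ S, ∀ i, a i ≤ y i ∧ y i < a i + N)
    (hS : ∀ y ∈ S, ∑ i, w i * y i = c) :
    (S.card : ℝ) ≤ 3 ^ (r + 1) * ((N : ℝ) ^ r + (N : ℝ) ^ (r + 1) / (w i₀).natAbs) := by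
  have hinj : Set.InjOn (fun (y : Fin (r + 2) → ℤ) => i₀.removeNth y) S := by
    intro y hy y' hy' h
    have h1 := (hS y hy).trans (hS y' hy').symm
    rw [Fin.sum_univ_succAbove _ i₀, Fin.sum_univ_succAbove _ i₀] at h1
    have h2 : ∀ j, y (i₀.succAbove j) = y' (i₀.succAbove j) := fun j => congrFun h j
    simp only [h2, add_left_inj] at h1
    have h3 := mul_left_cancel₀ hi₀ h1
    funext j
    refine Fin.succAboveCases i₀ h3 h2 j
  -- The coordinate i₀ is determined by the others, which satisfy a primitive congruence modulo |w
  -- i₀|.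
  have key := card_congruence_mul_le hN (r + 1) (i₀.removeNth w) (i₀.removeNth a)
    (w i₀).natAbs c (S.image (fun y => i₀.removeNth y)) (Int.natAbs_pos.2 hi₀)
    (fun d hd hdw => hp d (fun i => Fin.succAboveCases i₀ (Int.natCast_dvd.2 hd) hdw i))
    (by
      intro y hy i
      obtain ⟨z, hz, rfl⟩ := Finset.mem_image.1 hy
      exact hbox z hz _)
    (by
      intro y hy
      obtain ⟨z, hz, rfl⟩ := Finset.mem_image.1 hy
      have h1 := hS z hz
      rw [Fin.sum_univ_succAbove _ i₀] at h1
      rw [Int.natAbs_dvd]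
      refine ⟨-z i₀, ?_⟩
      simp only [Fin.removeNth]
      linarith)
  rw [Finset.card_image_of_injOn hinj] at key
  have hN0 : (0 : ℝ) < N := by exact_mod_cast hN
  refine le_of_mul_le_mul_right (key.trans (le_of_eq ?_)) hN0
  ring

/-! ### Primitive vectors and sums of inverse norms. -/

/-- The supremum norm of an integer vector, as a natural number. -/
def supAbs {n : ℕ} (w : Fin n → ℤ) : ℕ := Finset.univ.sup (fun i => (w i).natAbs)

theorem natAbs_le_supAbs {n : ℕ} (w : Fin n → ℤ) (i : Fin n) : (w i).natAbs ≤ supAbs w :=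
  Finset.le_sup (f := fun i => (w i).natAbs) (Finset.mem_univ i)

theorem exists_supAbs_eq {n : ℕ} (w : Fin (n + 1) → ℤ) : ∃ i, supAbs w = (w i).natAbs := by
  obtain ⟨i, -, hi⟩ := Finset.exists_mem_eq_sup Finset.univ Finset.univ_nonempty
    (fun i => (w i).natAbs)
  exact ⟨i, hi⟩

theorem supAbs_pos {n : ℕ} {w : Fin n → ℤ} (hw : w ≠ 0) : 0 < supAbs w := by
  obtain ⟨i, hi⟩ := Function.ne_iff.1 hw
  exact (Int.natAbs_pos.2 hi).trans_le (natAbs_le_supAbs w i)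

/-- An integer vector is primitive if its coordinates have no common divisor but `1`. -/
def IsPrimitiveVector {n : ℕ} (w : Fin n → ℤ) : Prop :=
  ∀ d : ℕ, (∀ i, (d : ℤ) ∣ w i) → d = 1

theorem IsPrimitiveVector.ne_zero {n : ℕ} {w : Fin n → ℤ} (hw : IsPrimitiveVector w) : w ≠ 0 := by
  rintro rfl
  exact absurd (hw 2 (fun i => dvd_zero _)) (by norm_num)

theorem exists_primitivePart (n : ℕ) : ∃ f : (Fin n → ℤ) → (Fin n → ℤ), ∀ x, x ≠ 0 →
    IsPrimitiveVector (f x) ∧ ∃ d : ℤ, x = d • f x := by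
  have key : ∀ x : Fin n → ℤ, ∃ w : Fin n → ℤ, x ≠ 0 → IsPrimitiveVector w ∧ ∃ d : ℤ, x = d • w := by
    intro x
    by_cases hx : x = 0
    · exact ⟨0, fun h => absurd hx h⟩
    obtain ⟨i, -⟩ := Function.ne_iff.1 hx
    obtain ⟨w, hw, hg⟩ := Finset.extract_gcd x (s := Finset.univ) ⟨i, Finset.mem_univ i⟩
    refine ⟨w, fun _ => ⟨fun d hd => ?_, Finset.univ.gcd x, ?_⟩⟩
    · have h1 : (d : ℤ) ∣ Finset.univ.gcd w := Finset.dvd_gcd (fun i _ => hd i)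
      rw [hg] at h1
      exact Nat.dvd_one.1 (by exact_mod_cast h1)
    · funext i
      simpa using hw i (Finset.mem_univ i)
  choose f hf using key
  exact ⟨f, hf⟩

/-- The number of integer vectors of supremum norm `M`. -/
theorem card_shell_le (n M : ℕ) (hM : 0 < M) (W : Finset (Fin n → ℤ))
    (hW : ∀ w ∈ W, supAbs w = M) : (W.card : ℝ) ≤ 2 * n * (3 * M) ^ (n - 1) := by
  have hM1 : (1 : ℝ) ≤ M := by exact_mod_cast hM
  set B : ℤ → Finset (Fin n → ℤ) := fun m => Fintype.piFinset (fun _ => Finset.Icc (-m) m) with hB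
  have hcard : ∀ m : ℕ, ((B m).card : ℝ) = (2 * m + 1) ^ n := by
    intro m
    have h1 : ((m : ℤ) + 1 - -m).toNat = 2 * m + 1 := by omega
    simp only [hB, Fintype.card_piFinset, Int.card_Icc, h1, Finset.prod_const, Finset.card_univ,
      Fintype.card_fin]
    push_cast
    rfl
  have hsub : B ((M - 1 : ℕ) : ℤ) ⊆ B M := by
    refine Fintype.piFinset_subset _ _ (fun _ => Finset.Icc_subset_Icc ?_ ?_) <;> omega
  -- The shell is the difference of two concentric cubes, with 2M + 1 and 2M - 1 points per side.
  have hWsub : W ⊆ B M \ B ((M - 1 : ℕ) : ℤ) := by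
    intro w hw
    have h := hW w hw
    simp only [hB, Finset.mem_sdiff, Fintype.mem_piFinset, Finset.mem_Icc]
    refine ⟨fun i => ?_, fun hc => ?_⟩
    · have := natAbs_le_supAbs w i
      omega
    · have : supAbs w ≤ M - 1 := Finset.sup_le (fun i _ => by
        have := hc i
        omega)
      omega
  have h1 := Finset.card_le_card hWsub
  have h2 : ((B M \ B ((M - 1 : ℕ) : ℤ)).card : ℝ) = (2 * M + 1) ^ n - (2 * M - 1) ^ n := by
    rw [Finset.cast_card_sdiff hsub, hcard, hcard]
    push_cast [Nat.cast_sub hM]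
    ring
  have h3 : (W.card : ℝ) ≤ (2 * M + 1) ^ n - (2 * M - 1) ^ n := by
    rw [← h2]
    exact_mod_cast h1
  have h4 := abs_pow_sub_pow_le (2 * M + 1 : ℝ) (2 * M - 1) n
  have h5 : |(2 * M + 1 : ℝ) - (2 * M - 1)| = 2 := by
    norm_num
  have h6 : max |(2 * M + 1 : ℝ)| |(2 * M - 1 : ℝ)| ≤ 3 * M := by
    rw [abs_of_nonneg (by positivity), abs_of_nonneg (by linarith)]
    exact max_le (by linarith) (by linarith)
  calc (W.card : ℝ) ≤ _ := h3.trans ((le_abs_self _).trans h4)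
    _ ≤ 2 * n * (3 * M) ^ (n - 1) := by
      rw [h5]
      gcongr

/-- The radial sum `∑ M ^ (k - 1)` over `1 ≤ M < N`. -/
noncomputable def radialSum (k N : ℕ) : ℝ := ∑ M ∈ Finset.Ico 1 N, (M : ℝ) ^ (k + 1) / (M : ℝ) ^ 2

theorem radialSum_nonneg (k N : ℕ) : 0 ≤ radialSum k N :=
  Finset.sum_nonneg (fun _ _ => by positivity)

/-- Group by norm: the shell of radius M has O(M^(k+1)) vectors, each contributing M^(-2). -/
theorem sum_inv_supAbs_sq_le (k N : ℕ) (W : Finset (Fin (k + 2) → ℤ))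
    (hW : ∀ w ∈ W, 0 < supAbs w ∧ supAbs w < N) :
    ∑ w ∈ W, 1 / (supAbs w : ℝ) ^ 2 ≤ 2 * (k + 2) * 3 ^ (k + 1) * radialSum k N := by
  rw [← Finset.sum_fiberwise_of_maps_to (t := Finset.Ico 1 N) (g := supAbs)
    (fun w hw => Finset.mem_Ico.2 (hW w hw)), radialSum, Finset.mul_sum]
  refine Finset.sum_le_sum (fun M hM => ?_)
  have hM0 : 0 < M := (Finset.mem_Ico.1 hM).1
  have h1 := card_shell_le (k + 2) M hM0 (W.filter (fun w => supAbs w = M))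
    (fun w hw => (Finset.mem_filter.1 hw).2)
  calc ∑ w ∈ W.filter (fun w => supAbs w = M), 1 / (supAbs w : ℝ) ^ 2
      = (W.filter (fun w => supAbs w = M)).card * (1 / (M : ℝ) ^ 2) := by
        rw [← nsmul_eq_mul]
        refine Finset.sum_eq_card_nsmul (fun w hw => ?_)
        rw [(Finset.mem_filter.1 hw).2]
    _ ≤ (2 * (k + 2 : ℕ) * (3 * M) ^ (k + 2 - 1)) * (1 / (M : ℝ) ^ 2) := by gcongr
    _ = _ := by
        push_cast
        simp only [mul_pow]
        ring

/-- The multiples of one primitive vector in a cube. -/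
theorem card_multiples_le {n N : ℕ} (p w : Fin (n + 1) → ℤ) (hw : w ≠ 0)
    (X : Finset (Fin (n + 1) → ℤ)) (hbox : ∀ x ∈ X, ∀ i, p i ≤ x i ∧ x i < p i + N)
    (hX : ∀ x ∈ X, ∃ d : ℤ, x = d • w) : (X.card : ℝ) ≤ 1 + N / supAbs w := by
  -- In a coordinate of largest modulus, distinct multiples of w are at least `supAbs w` apart.
  obtain ⟨i, hi⟩ := exists_supAbs_eq w
  have hpos := supAbs_pos hw
  have hwi : w i ≠ 0 := by
    rw [hi] at hpos
    exact Int.natAbs_pos.1 hpos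
  have hinj : Set.InjOn (fun x : Fin (n + 1) → ℤ => x i) X := by
    intro x hx y hy h
    obtain ⟨d, rfl⟩ := hX x hx
    obtain ⟨e, rfl⟩ := hX y hy
    have : d = e := by simpa [hwi] using h
    rw [this]
  rw [← Finset.card_image_of_injOn hinj]
  refine card_le_of_dvd_sub (a := p i) hpos ?_ ?_
  · intro t ht
    obtain ⟨x, hx, rfl⟩ := Finset.mem_image.1 ht
    exact hbox x hx i
  · intro t ht t' ht'
    obtain ⟨x, hx, rfl⟩ := Finset.mem_image.1 ht
    obtain ⟨y, hy, rfl⟩ := Finset.mem_image.1 ht'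
    obtain ⟨d, rfl⟩ := hX x hx
    obtain ⟨e, rfl⟩ := hX y hy
    rw [hi, Int.natAbs_dvd]
    exact ⟨d - e, by simp; ring⟩

theorem card_cube_le {n N : ℕ} (p : Fin n → ℤ) (X : Finset (Fin n → ℤ))
    (hbox : ∀ x ∈ X, ∀ i, p i ≤ x i ∧ x i < p i + N) : (X.card : ℝ) ≤ (N : ℝ) ^ n := by
  have h1 : X ⊆ Fintype.piFinset (fun i => Finset.Ico (p i) (p i + N)) := by
    intro x hx
    simpa [Fintype.mem_piFinset] using hbox x hx
  have h2 := Finset.card_le_card h1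
  simp only [Fintype.card_piFinset, Int.card_Ico, add_sub_cancel_left, Int.toNat_natCast,
    Finset.prod_const, Finset.card_univ, Fintype.card_fin] at h2
  exact_mod_cast h2

/-- The sum over a cube of the inverse norms of the primitive parts. -/
theorem sum_inv_primitivePart_le {k N : ℕ} (hN : 0 < N) (f : (Fin (k + 2) → ℤ) → (Fin (k + 2) → ℤ))
    (hf : ∀ x, x ≠ 0 → IsPrimitiveVector (f x) ∧ ∃ d : ℤ, x = d • f x) (p : Fin (k + 2) → ℤ)
    (X : Finset (Fin (k + 2) → ℤ)) (hbox : ∀ x ∈ X, ∀ i, p i ≤ x i ∧ x i < p i + N)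
    (hX : ∀ x ∈ X, x ≠ 0) :
    ∑ x ∈ X, 1 / (supAbs (f x) : ℝ) ≤
      (N : ℝ) ^ (k + 1) + 2 * N * (2 * (k + 2) * 3 ^ (k + 1) * radialSum k N) := by
  have hN0 : (0 : ℝ) < N := by exact_mod_cast hN
  -- Norms at least N contribute at most N^(k+2)/N. Below N, the fibre bound 1 + N/|w| is at most
  -- 2N/|w|.
  rw [← Finset.sum_filter_not_add_sum_filter X (fun x => supAbs (f x) < N)]
  refine add_le_add ?_ ?_
  · calc ∑ x ∈ X.filter (fun x => ¬ supAbs (f x) < N), 1 / (supAbs (f x) : ℝ)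
        ≤ ∑ x ∈ X.filter (fun x => ¬ supAbs (f x) < N), 1 / (N : ℝ) := by
          refine Finset.sum_le_sum (fun x hx => ?_)
          have : N ≤ supAbs (f x) := not_lt.1 (Finset.mem_filter.1 hx).2
          gcongr
      _ = (X.filter (fun x => ¬ supAbs (f x) < N)).card * (1 / (N : ℝ)) := by simp
      _ ≤ (N : ℝ) ^ (k + 2) * (1 / (N : ℝ)) := by
          gcongr
          exact card_cube_le p _ (fun x hx => hbox x (Finset.mem_filter.1 hx).1)
      _ = _ := by
          field_simp
          ring
  · set Y := X.filter (fun x => supAbs (f x) < N)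
    have hY : ∀ x ∈ Y, x ∈ X ∧ supAbs (f x) < N := fun x hx => Finset.mem_filter.1 hx
    have hW : ∀ w ∈ Y.image f, 0 < supAbs w ∧ supAbs w < N := by
      intro w hw
      obtain ⟨x, hx, rfl⟩ := Finset.mem_image.1 hw
      exact ⟨supAbs_pos (hf x (hX x (hY x hx).1)).1.ne_zero, (hY x hx).2⟩
    rw [Finset.sum_comp (fun w => 1 / (supAbs w : ℝ)) f]
    calc _ ≤ ∑ w ∈ Y.image f, 2 * (N : ℝ) * (1 / (supAbs w : ℝ) ^ 2) := by
          refine Finset.sum_le_sum (fun w hw => ?_)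
          obtain ⟨hw0, hwN⟩ := hW w hw
          have hw0' : (0 : ℝ) < supAbs w := by exact_mod_cast hw0
          have hwN' : (supAbs w : ℝ) ≤ N := by exact_mod_cast hwN.le
          have hwne : w ≠ 0 := by
            obtain ⟨x, hx, rfl⟩ := Finset.mem_image.1 hw
            exact (hf x (hX x (hY x hx).1)).1.ne_zero
          have h1 := card_multiples_le p w hwne (Y.filter (fun x => f x = w))
            (fun x hx => hbox x (hY x (Finset.mem_filter.1 hx).1).1)
            (fun x hx => by
              obtain ⟨h, h'⟩ := Finset.mem_filter.1 hx
              have := (hf x (hX x (hY x h).1)).2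
              rwa [h'] at this)
          have h2 : (1 : ℝ) ≤ N / supAbs w := (one_le_div hw0').2 hwN'
          rw [nsmul_eq_mul]
          calc _ ≤ ((N : ℝ) / supAbs w + N / supAbs w) * (1 / (supAbs w : ℝ)) := by
                gcongr
                linarith
            _ = _ := by
                field_simp
                ring
      _ = 2 * (N : ℝ) * ∑ w ∈ Y.image f, 1 / (supAbs w : ℝ) ^ 2 := by rw [Finset.mul_sum]
      _ ≤ _ := by
          gcongr
          exact sum_inv_supAbs_sq_le k N _ hW

/-! ### Pairs with a prescribed inner product. -/

/-- The number of pairs of points of two cubes with a given inner product, uniformly in the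
position of the cubes. -/
theorem exists_card_pairs_le (k : ℕ) : ∃ C : ℝ, 0 ≤ C ∧ ∀ (N : ℕ), 0 < N →
    ∀ (p q : Fin (k + 2) → ℤ) (m : ℤ) (S : Finset ((Fin (k + 2) → ℤ) × (Fin (k + 2) → ℤ))),
    (∀ z ∈ S, ∀ i, p i ≤ z.1 i ∧ z.1 i < p i + N) →
    (∀ z ∈ S, ∀ i, q i ≤ z.2 i ∧ z.2 i < q i + N) →
    (∀ z ∈ S, ∑ i, z.1 i * z.2 i = m) →
    (S.card : ℝ) ≤ C * ((N : ℝ) ^ (2 * k + 2) + (N : ℝ) ^ (k + 2) * radialSum k N) := by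
  obtain ⟨f, hf⟩ := exists_primitivePart (k + 2)
  set D : ℝ := 2 * (k + 2) * 3 ^ (k + 1) with hD
  have hD0 : 0 ≤ D := by positivity
  refine ⟨1 + 2 * 3 ^ (k + 1) + 2 * 3 ^ (k + 1) * D, by positivity, ?_⟩
  intro N hN p q m S hp hq hm
  have hN1 : (1 : ℝ) ≤ N := by exact_mod_cast hN
  have hE := radialSum_nonneg k N
  set X := S.image Prod.fst with hXdef
  have hXbox : ∀ x ∈ X, ∀ i, p i ≤ x i ∧ x i < p i + N := by
    intro x hx
    obtain ⟨z, hz, rfl⟩ := Finset.mem_image.1 hx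
    exact hp z hz
  set F : (Fin (k + 2) → ℤ) → Finset (Fin (k + 2) → ℤ) := fun x =>
    (S.filter (fun z => z.1 = x)).image Prod.snd
  have hF : ∀ x y, y ∈ F x ↔ (x, y) ∈ S := by
    intro x y
    simp [F]
  have hFcard : ∀ x, ((S.filter (fun z => z.1 = x)).card : ℝ) = (F x).card := by
    intro x
    rw [Finset.card_image_of_injOn]
    rintro ⟨z1, z2⟩ hz ⟨z1', z2'⟩ hz' h
    simp only [Finset.coe_filter, Set.mem_ofPred_eq] at hz hz' h
    simp [hz.2, hz'.2, h]
  have hFq : ∀ x, ∀ y ∈ F x, ∀ i, q i ≤ y i ∧ y i < q i + N :=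
    fun x y hy => hq _ ((hF x y).1 hy)
  have hsum : (S.card : ℝ) = ∑ x ∈ X, ((F x).card : ℝ) := by
    rw [Finset.card_eq_sum_card_image Prod.fst S]
    push_cast
    exact Finset.sum_congr rfl (fun x _ => hFcard x)
  -- If x = 0, then y is unconstrained within its cube; this costs N^(k+2) ≤ N^(2k+2).
  have hzero : ∑ x ∈ X.filter (fun x => x = 0), ((F x).card : ℝ) ≤ (N : ℝ) ^ (k + 2) := by
    calc _ ≤ ∑ x ∈ ({0} : Finset (Fin (k + 2) → ℤ)), ((F x).card : ℝ) := by
          refine Finset.sum_le_sum_of_subset_of_nonneg ?_ (fun _ _ _ => by positivity)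
          intro x hx
          simpa using (Finset.mem_filter.1 hx).2
      _ ≤ _ := by
          rw [Finset.sum_singleton]
          exact card_cube_le q _ (hFq 0)
  have hnz : ∑ x ∈ X.filter (fun x => ¬ x = 0), ((F x).card : ℝ) ≤
      3 ^ (k + 1) * ((N : ℝ) ^ k * (N : ℝ) ^ (k + 2) +
        (N : ℝ) ^ (k + 1) * ((N : ℝ) ^ (k + 1) + 2 * N * (D * radialSum k N))) := by
    calc _ ≤ ∑ x ∈ X.filter (fun x => ¬ x = 0),
          3 ^ (k + 1) * ((N : ℝ) ^ k + (N : ℝ) ^ (k + 1) * (1 / supAbs (f x))) := by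
          refine Finset.sum_le_sum (fun x hx => ?_)
          obtain ⟨hxX, hx0⟩ := Finset.mem_filter.1 hx
          obtain ⟨hprim, d, hd⟩ := hf x hx0
          obtain ⟨i, hi⟩ := exists_supAbs_eq (f x)
          have hpos := supAbs_pos hprim.ne_zero
          rw [hi] at hpos
          have hd0 : d ≠ 0 := by
            rintro rfl
            exact hx0 (by rw [hd, zero_smul])
          -- With x = d w, the equation becomes w·y = m / d; the division is exact as soon as some y
          -- exists.
          have := card_hyperplane_le hN (f x) q (m / d) i (Int.natAbs_pos.1 hpos) (F x) hprim
            (hFq x) (fun y hy => by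
              have h1 := hm _ ((hF x y).1 hy)
              simp only at h1
              rw [hd] at h1
              simp only [Pi.smul_apply, smul_eq_mul, mul_assoc] at h1
              rw [← Finset.mul_sum] at h1
              rw [← h1, Int.mul_ediv_cancel_left _ hd0])
          rw [hi]
          simpa only [mul_one_div] using this
      _ = 3 ^ (k + 1) * ((N : ℝ) ^ k * (X.filter (fun x => ¬ x = 0)).card +
            (N : ℝ) ^ (k + 1) * ∑ x ∈ X.filter (fun x => ¬ x = 0), 1 / (supAbs (f x) : ℝ)) := by
          rw [← Finset.mul_sum, Finset.sum_add_distrib, ← Finset.mul_sum, Finset.sum_const,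
            nsmul_eq_mul, mul_comm (Nat.cast _) ((N : ℝ) ^ k)]
      _ ≤ _ := by
          gcongr
          · exact card_cube_le p _ (fun x hx => hXbox x (Finset.mem_filter.1 hx).1)
          · exact sum_inv_primitivePart_le hN f hf p _
              (fun x hx => hXbox x (Finset.mem_filter.1 hx).1)
              (fun x hx => (Finset.mem_filter.1 hx).2)
  rw [hsum, ← Finset.sum_filter_add_sum_filter_not X (fun x => x = 0)]
  have hle : (N : ℝ) ^ (k + 2) ≤ (N : ℝ) ^ (2 * k + 2) := pow_le_pow_right₀ hN1 (by omega)
  have hA : 0 ≤ (N : ℝ) ^ (2 * k + 2) := by positivity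
  have hB : 0 ≤ (N : ℝ) ^ (k + 2) * radialSum k N := by positivity
  have hT : (0 : ℝ) ≤ 3 ^ (k + 1) := by positivity
  have e1 : 3 ^ (k + 1) * ((N : ℝ) ^ k * (N : ℝ) ^ (k + 2) +
        (N : ℝ) ^ (k + 1) * ((N : ℝ) ^ (k + 1) + 2 * N * (D * radialSum k N))) =
      2 * 3 ^ (k + 1) * (N : ℝ) ^ (2 * k + 2) +
        2 * 3 ^ (k + 1) * D * ((N : ℝ) ^ (k + 2) * radialSum k N) := by ring
  rw [e1] at hnz
  have h1 : 0 ≤ 2 * (3 : ℝ) ^ (k + 1) * D * (N : ℝ) ^ (2 * k + 2) := by positivity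
  have h2 : 0 ≤ (1 + 2 * (3 : ℝ) ^ (k + 1)) * ((N : ℝ) ^ (k + 2) * radialSum k N) := by positivity
  linarith

/-! ### From the radial sum to the rate in L. -/

theorem radialSum_zero_le (N : ℕ) : radialSum 0 N ≤ 1 + Real.log N := by
  have h := harmonic_le_one_add_log N
  rw [harmonic_eq_sum_Icc, Rat.cast_sum] at h
  refine le_trans ?_ h
  have : radialSum 0 N = ∑ M ∈ Finset.Ico 1 N, (((M : ℚ)⁻¹ : ℚ) : ℝ) := by
    refine Finset.sum_congr rfl (fun M hM => ?_)
    have : (M : ℝ) ≠ 0 := by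
      have := (Finset.mem_Ico.1 hM).1
      positivity
    push_cast
    field_simp
  rw [this]
  refine Finset.sum_le_sum_of_subset_of_nonneg Finset.Ico_subset_Icc_self (fun _ _ _ => ?_)
  positivity

theorem radialSum_succ_le (k N : ℕ) : radialSum (k + 1) N ≤ (N : ℝ) ^ (k + 1) := by
  calc radialSum (k + 1) N ≤ ∑ M ∈ Finset.Ico 1 N, (N : ℝ) ^ k := by
        refine Finset.sum_le_sum (fun M hM => ?_)
        obtain ⟨h1, h2⟩ := Finset.mem_Ico.1 hM
        have hM0 : (M : ℝ) ≠ 0 := by positivity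
        calc (M : ℝ) ^ (k + 1 + 1) / (M : ℝ) ^ 2 = (M : ℝ) ^ k := by
              field_simp
              ring
          _ ≤ _ := by gcongr
    _ = ((N - 1 : ℕ) : ℝ) * (N : ℝ) ^ k := by simp
    _ ≤ N * (N : ℝ) ^ k := by
        gcongr
        omega
    _ = _ := by ring

theorem resonantRate_nonneg {n : ℕ} {L : ℝ} (hL : 2 ≤ L) : 0 ≤ resonantRate n L := by
  have := Real.log_nonneg (show (1 : ℝ) ≤ L by linarith)
  unfold resonantRate
  split_ifs <;> positivity

/-- Only n = 2 meets the harmonic sum; for n > 2 both terms have order N^(2n-2). The assumption L ≥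
2 gives ⌈L⌉ ≤ 2L and lets log L absorb constants. -/
theorem exists_pow_radialSum_le_resonantRate (k : ℕ) : ∃ C : ℝ, 0 ≤ C ∧ ∀ L : ℝ, 2 ≤ L →
    (⌈L⌉₊ : ℝ) ^ (2 * k + 2) + (⌈L⌉₊ : ℝ) ^ (k + 2) * radialSum k ⌈L⌉₊ ≤
      C * resonantRate (k + 2) L := by
  have hceil : ∀ L : ℝ, 2 ≤ L → (⌈L⌉₊ : ℝ) ≤ 2 * L := fun L hL => by
    have := Nat.ceil_lt_add_one (show 0 ≤ L by linarith)
    linarith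
  rcases k with _ | k
  -- 24 = 4 · 6: N² ≤ 4L², and 2 + log 2 + log L ≤ 6 log L.
  · refine ⟨24, by norm_num, fun L hL => ?_⟩
    have hN := hceil L hL
    have hNpos : (0 : ℝ) < ⌈L⌉₊ := by
      exact_mod_cast Nat.ceil_pos.2 (show 0 < L by linarith)
    have h1 := radialSum_zero_le ⌈L⌉₊
    have h2 : Real.log ⌈L⌉₊ ≤ Real.log 2 + Real.log L := by
      rw [← Real.log_mul (by norm_num) (by linarith)]
      exact Real.log_le_log hNpos hN
    have h3 : Real.log 2 ≤ Real.log L := Real.log_le_log (by norm_num) hL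
    have h4 := Real.log_two_gt_d9
    have h5 : 1 ≤ 2 * Real.log L := by linarith
    have h6 := radialSum_nonneg 0 ⌈L⌉₊
    have h7 : (⌈L⌉₊ : ℝ) ^ 2 ≤ (2 * L) ^ 2 := by gcongr
    simp only [resonantRate, mul_zero, zero_add, if_true]
    calc (⌈L⌉₊ : ℝ) ^ 2 + (⌈L⌉₊ : ℝ) ^ 2 * radialSum 0 ⌈L⌉₊
        = (⌈L⌉₊ : ℝ) ^ 2 * (1 + radialSum 0 ⌈L⌉₊) := by ring
      _ ≤ (2 * L) ^ 2 * (6 * Real.log L) := by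
          gcongr
          linarith
      _ = _ := by ring
  · refine ⟨2 * 2 ^ (2 * (k + 1) + 2), by positivity, fun L hL => ?_⟩
    have hN := hceil L hL
    have hne : k + 1 + 2 ≠ 2 := by omega
    have he : 2 * (k + 1 + 2) - 2 = 2 * (k + 1) + 2 := by omega
    simp only [resonantRate, hne, if_false, he]
    calc _ ≤ (⌈L⌉₊ : ℝ) ^ (2 * (k + 1) + 2) +
          (⌈L⌉₊ : ℝ) ^ (k + 1 + 2) * (⌈L⌉₊ : ℝ) ^ (k + 1) := by
          gcongr
          exact radialSum_succ_le k _
      _ = 2 * (⌈L⌉₊ : ℝ) ^ (2 * (k + 1) + 2) := by ring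
      _ ≤ 2 * (2 * L) ^ (2 * (k + 1) + 2) := by gcongr
      _ = _ := by rw [mul_pow]; ring

theorem exists_card_pairs_le_resonantRate (k : ℕ) : ∃ C : ℝ, 0 ≤ C ∧ ∀ L : ℝ, 2 ≤ L →
    ∀ (p q : Fin (k + 2) → ℤ) (m : ℤ) (S : Finset ((Fin (k + 2) → ℤ) × (Fin (k + 2) → ℤ))),
    (∀ z ∈ S, ∀ i, p i ≤ z.1 i ∧ z.1 i < p i + ⌈L⌉₊) →
    (∀ z ∈ S, ∀ i, q i ≤ z.2 i ∧ z.2 i < q i + ⌈L⌉₊) →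
    (∀ z ∈ S, ∑ i, z.1 i * z.2 i = m) →
    (S.card : ℝ) ≤ C * resonantRate (k + 2) L := by
  obtain ⟨C₁, hC₁, h₁⟩ := exists_card_pairs_le k
  obtain ⟨C₂, hC₂, h₂⟩ := exists_pow_radialSum_le_resonantRate k
  refine ⟨C₁ * C₂, by positivity, fun L hL p q m S hp hq hm => ?_⟩
  calc (S.card : ℝ) ≤ _ := h₁ _ (Nat.ceil_pos.2 (by linarith)) p q m S hp hq hm
    _ ≤ C₁ * (C₂ * resonantRate (k + 2) L) := by
        gcongr
        exact h₂ L hL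
    _ = _ := by ring

/-! ### Weighted counts by decomposition into cells. -/

/-- The one-dimensional weight `(1 + x²)^{-t}`. -/
noncomputable def lineWeight (t x : ℝ) : ℝ := (1 + x ^ 2) ^ (-t)

theorem lineWeight_nonneg (t x : ℝ) : 0 ≤ lineWeight t x := by
  unfold lineWeight
  positivity

theorem summable_lineWeight {t : ℝ} (ht : 1 / 2 < t) :
    Summable (fun j : ℤ => lineWeight t j) := by
  refine Summable.of_norm_bounded_eventually
    (Real.summable_abs_int_rpow (b := 2 * t) (by linarith)) ?_
  refine (Set.finite_singleton (0 : ℤ)).subset ?_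
  intro j hj
  by_contra h0
  refine hj ?_
  change ‖lineWeight t (j : ℝ)‖ ≤ |(j : ℝ)| ^ (-(2 * t))
  have hj0 : (0 : ℝ) < |(j : ℝ)| := by
    rw [abs_pos]
    exact_mod_cast h0
  rw [Real.norm_of_nonneg (lineWeight_nonneg _ _), lineWeight,
    show -(2 * t) = 2 * (-t) by ring, Real.rpow_mul hj0.le, Real.rpow_two, sq_abs]
  refine Real.rpow_le_rpow_of_nonpos ?_ (by linarith) (by linarith)
  rw [← sq_abs]
  positivity

/-- Integer division by N = ⌈L⌉ is a floor, so the cell index j satisfies |j| ≤ |x/L| + 1, whence 1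
+ j² ≤ 3(1 + (x/L)²). The weight is thus dominated by one constant on each cell. -/
theorem lineWeight_div_le {t : ℝ} (ht : 0 ≤ t) {L : ℝ} (hL : 2 ≤ L) (x : ℤ) :
    lineWeight t (x / L) ≤ 3 ^ t * lineWeight t ((x / (⌈L⌉₊ : ℤ) : ℤ) : ℝ) := by
  have hN : (0 : ℝ) < ⌈L⌉₊ := by exact_mod_cast Nat.ceil_pos.2 (show 0 < L by linarith)
  have hNL : L ≤ ⌈L⌉₊ := Nat.le_ceil L
  have hj : ((x / (⌈L⌉₊ : ℤ) : ℤ) : ℝ) = ⌊(x : ℝ) / ⌈L⌉₊⌋ := by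
    rw [Int.floor_div_natCast]
    simp
  set j : ℝ := ((x / (⌈L⌉₊ : ℤ) : ℤ) : ℝ)
  have h1 : j ≤ (x : ℝ) / ⌈L⌉₊ := hj ▸ Int.floor_le _
  have h2 : (x : ℝ) / ⌈L⌉₊ < j + 1 := hj ▸ Int.lt_floor_add_one _
  have h3 : |(x : ℝ) / ⌈L⌉₊| ≤ |(x : ℝ) / L| := by
    rw [abs_div, abs_div, abs_of_pos hN, abs_of_pos (show 0 < L by linarith)]
    gcongr
  have h4 : |j| ≤ |(x : ℝ) / L| + 1 := by
    have := abs_le.1 h3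
    rw [abs_le]
    constructor <;> linarith
  have h5 : 1 + j ^ 2 ≤ 3 * (1 + (x / L : ℝ) ^ 2) := by
    rw [← sq_abs j, ← sq_abs (x / L : ℝ)]
    nlinarith [abs_nonneg j, sq_nonneg (|(x : ℝ) / L| - 1)]
  unfold lineWeight
  have h6 : (3 * (1 + (x / L : ℝ) ^ 2)) ^ (-t) ≤ (1 + j ^ 2) ^ (-t) :=
    Real.rpow_le_rpow_of_nonpos (by positivity) h5 (by linarith)
  rw [Real.mul_rpow (by norm_num) (by positivity), Real.rpow_neg (by norm_num)] at h6
  have h7 : (0 : ℝ) < 3 ^ t := by positivity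
  rwa [inv_mul_le_iff₀ h7] at h6

theorem sum_prod_le_tsum_pow {n : ℕ} {W : ℤ → ℝ} (hW : ∀ j, 0 ≤ W j) (hs : Summable W)
    (A : Finset (Fin n → ℤ)) : ∑ j ∈ A, ∏ i, W (j i) ≤ (∑' j, W j) ^ n := by
  calc ∑ j ∈ A, ∏ i, W (j i)
      ≤ ∑ j ∈ Fintype.piFinset (fun i => A.image (fun j => j i)), ∏ i, W (j i) := by
        refine Finset.sum_le_sum_of_subset_of_nonneg ?_
          (fun _ _ _ => Finset.prod_nonneg (fun _ _ => hW _))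
        intro j hj
        exact Fintype.mem_piFinset.2 (fun i => Finset.mem_image_of_mem _ hj)
    _ = ∏ i, ∑ j ∈ A.image (fun j => j i), W j := by rw [Finset.prod_univ_sum]
    _ ≤ ∏ _i : Fin n, ∑' j, W j := by
        refine Finset.prod_le_prod (fun _ _ => Finset.sum_nonneg (fun _ _ => hW _)) (fun i _ => ?_)
        exact hs.sum_le_tsum _ (fun _ _ => hW _)
    _ = _ := by simp

/-- The product weight on vectors. -/
noncomputable def boxWeight {n : ℕ} (t : ℝ) (x : Fin n → ℝ) : ℝ := ∏ i, lineWeight t (x i)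

theorem boxWeight_nonneg {n : ℕ} (t : ℝ) (x : Fin n → ℝ) : 0 ≤ boxWeight t x :=
  Finset.prod_nonneg (fun _ _ => lineWeight_nonneg _ _)

/-- The weighted number of pairs of translated lattice points with a given inner product. -/
theorem exists_sum_boxWeight_le (k : ℕ) {t : ℝ} (ht : 1 / 2 < t) : ∃ C : ℝ, 0 ≤ C ∧
    ∀ L : ℝ, 2 ≤ L → ∀ (p q : Fin (k + 2) → ℤ) (m : ℤ)
    (F : Finset ((Fin (k + 2) → ℤ) × (Fin (k + 2) → ℤ))),
    (∀ z ∈ F, ∑ i, z.1 i * z.2 i = m) →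
    ∑ z ∈ F, boxWeight t (fun i => ((z.1 i + p i : ℤ) : ℝ) / L) *
      boxWeight t (fun i => ((z.2 i + q i : ℤ) : ℝ) / L) ≤ C * resonantRate (k + 2) L := by
  obtain ⟨C, hC, hcount⟩ := exists_card_pairs_le_resonantRate k
  set W : ℤ → ℝ := fun j => 3 ^ t * lineWeight t j with hWdef
  have hW : ∀ j, 0 ≤ W j := fun j => mul_nonneg (by positivity) (lineWeight_nonneg _ _)
  have hWs : Summable W := (summable_lineWeight ht).mul_left _
  have hT : 0 ≤ ∑' j, W j := tsum_nonneg hW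
  refine ⟨C * ((∑' j, W j) ^ (k + 2) * (∑' j, W j) ^ (k + 2)), by positivity,
    fun L hL p q m F hF => ?_⟩
  have hN : 0 < (⌈L⌉₊ : ℤ) := by exact_mod_cast Nat.ceil_pos.2 (show 0 < L by linarith)
  have hrate := resonantRate_nonneg (n := k + 2) hL
  -- `cell p x` indexes the cube containing x + p. The shift moves the weight but not the equation,
  -- so the count must be uniform in the position of the cubes.
  set cell : (Fin (k + 2) → ℤ) → (Fin (k + 2) → ℤ) → (Fin (k + 2) → ℤ) :=
    fun p x i => (x i + p i) / (⌈L⌉₊ : ℤ) with hcell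
  set G : (Fin (k + 2) → ℤ) × (Fin (k + 2) → ℤ) → ℝ :=
    fun J => (∏ i, W (J.1 i)) * ∏ i, W (J.2 i) with hG
  have hprod : ∀ j : Fin (k + 2) → ℤ, 0 ≤ ∏ i, W (j i) :=
    fun j => Finset.prod_nonneg (fun _ _ => hW _)
  have hG0 : ∀ J, 0 ≤ G J := fun J => mul_nonneg (hprod _) (hprod _)
  have hbox : ∀ p x : Fin (k + 2) → ℤ,
      boxWeight t (fun i => ((x i + p i : ℤ) : ℝ) / L) ≤ ∏ i, W (cell p x i) := fun p x =>
    Finset.prod_le_prod (fun _ _ => lineWeight_nonneg _ _)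
      (fun i _ => lineWeight_div_le (by linarith) hL _)
  have hmem : ∀ p x j : Fin (k + 2) → ℤ, cell p x = j →
      ∀ i, (⌈L⌉₊ * j i - p i) ≤ x i ∧ x i < (⌈L⌉₊ * j i - p i) + ⌈L⌉₊ := by
    rintro p x j rfl i
    have h1 := Int.mul_ediv_self_le (x := x i + p i) hN.ne'
    have h2 := Int.lt_mul_ediv_self_add (x := x i + p i) hN
    simp only [hcell]
    constructor <;> linarith
  set c : (Fin (k + 2) → ℤ) × (Fin (k + 2) → ℤ) → (Fin (k + 2) → ℤ) × (Fin (k + 2) → ℤ) :=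
    fun z => (cell p z.1, cell q z.2) with hc
  calc _ ≤ ∑ z ∈ F, G (c z) := Finset.sum_le_sum (fun z _ =>
        mul_le_mul (hbox p z.1) (hbox q z.2) (boxWeight_nonneg _ _) (hprod _))
    _ = ∑ J ∈ F.image c, ((F.filter (fun z => c z = J)).card : ℝ) * G J := by
        rw [Finset.sum_comp G c]
        simp only [nsmul_eq_mul]
    _ ≤ ∑ J ∈ F.image c, C * resonantRate (k + 2) L * G J := by
        refine Finset.sum_le_sum (fun J _ => mul_le_mul_of_nonneg_right ?_ (hG0 J))
        refine hcount L hL (fun i => ⌈L⌉₊ * J.1 i - p i) (fun i => ⌈L⌉₊ * J.2 i - q i) m _ ?_ ?_ ?_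
        · intro z hz
          exact hmem p z.1 J.1 (congrArg Prod.fst (Finset.mem_filter.1 hz).2)
        · intro z hz
          exact hmem q z.2 J.2 (congrArg Prod.snd (Finset.mem_filter.1 hz).2)
        · intro z hz
          exact hF z (Finset.mem_filter.1 hz).1
    _ = C * resonantRate (k + 2) L * ∑ J ∈ F.image c, G J := by rw [Finset.mul_sum]
    _ ≤ C * resonantRate (k + 2) L *
          ∑ J ∈ (F.image c).image Prod.fst ×ˢ (F.image c).image Prod.snd, G J := by
        refine mul_le_mul_of_nonneg_left ?_ (by positivity)
        refine Finset.sum_le_sum_of_subset_of_nonneg (fun J hJ => ?_) (fun J _ _ => hG0 J)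
        exact Finset.mem_product.2
          ⟨Finset.mem_image_of_mem _ hJ, Finset.mem_image_of_mem _ hJ⟩
    _ = C * resonantRate (k + 2) L * ((∑ j ∈ (F.image c).image Prod.fst, ∏ i, W (j i)) *
          ∑ j ∈ (F.image c).image Prod.snd, ∏ i, W (j i)) := by
        rw [Finset.sum_product, Finset.sum_mul_sum]
    _ ≤ C * resonantRate (k + 2) L * ((∑' j, W j) ^ (k + 2) * (∑' j, W j) ^ (k + 2)) := by
        gcongr
        · exact Finset.sum_nonneg (fun _ _ => hprod _)
        · exact sum_prod_le_tsum_pow hW hWs _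
        · exact sum_prod_le_tsum_pow hW hWs _
    _ = _ := by ring

/-! ### Inequalities for the Japanese bracket. -/

theorem jbracket_pos {n : ℕ} (K : EuclideanSpace ℝ (Fin n)) : 0 < jbracket K :=
  Real.sqrt_pos.2 (by positivity)

theorem one_le_jbracket {n : ℕ} (K : EuclideanSpace ℝ (Fin n)) : 1 ≤ jbracket K :=
  Real.one_le_sqrt.2 (by nlinarith [sq_nonneg ‖K‖])

theorem jbracket_sq {n : ℕ} (K : EuclideanSpace ℝ (Fin n)) : jbracket K ^ 2 = 1 + ‖K‖ ^ 2 :=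
  Real.sq_sqrt (by positivity)

/-- Each 1 + K_i² is at most 1 + |K|², so the radial decay can be shared equally among the n
coordinates. -/
theorem jbracket_rpow_le_boxWeight {n : ℕ} {t : ℝ} (ht : 0 ≤ t) (K : EuclideanSpace ℝ (Fin n)) :
    jbracket K ^ (-(2 * (n * t))) ≤ boxWeight t (fun i => K i) := by
  have h1 : jbracket K ^ (-(2 * (n * t))) = ((1 + ‖K‖ ^ 2) ^ (-t)) ^ n := by
    rw [show -(2 * (n * t)) = 2 * ((-t) * n) by ring, Real.rpow_mul (jbracket_pos K).le,
      Real.rpow_two, jbracket_sq, Real.rpow_mul (by positivity), Real.rpow_natCast]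
  have h2 : ((1 + ‖K‖ ^ 2) ^ (-t)) ^ n = ∏ _i : Fin n, (1 + ‖K‖ ^ 2) ^ (-t) := by simp
  rw [h1, h2]
  refine Finset.prod_le_prod (fun _ _ => by positivity) (fun i _ => ?_)
  refine Real.rpow_le_rpow_of_nonpos (by positivity) ?_ (by linarith)
  rw [EuclideanSpace.real_norm_sq_eq]
  have := Finset.single_le_sum (f := fun i => K i ^ 2) (fun i _ => sq_nonneg _) (Finset.mem_univ i)
  linarith

theorem jbracket_sub_le {n : ℕ} (X Y : EuclideanSpace ℝ (Fin n)) :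
    jbracket (X - Y) ≤ 2 * (jbracket X * jbracket Y) := by
  have hX := jbracket_pos X
  have hY := jbracket_pos Y
  refine le_of_sq_le_sq ?_ (by positivity)
  rw [mul_pow, mul_pow, jbracket_sq, jbracket_sq, jbracket_sq]
  have h := norm_sub_le X Y
  have h2 : ‖X - Y‖ ^ 2 ≤ (‖X‖ + ‖Y‖) ^ 2 := by gcongr
  nlinarith [sq_nonneg (‖X‖ - ‖Y‖), mul_nonneg (sq_nonneg ‖X‖) (sq_nonneg ‖Y‖)]

/-- Half of the decay in Y turns decay in X into decay in X - Y, by the Peetre-type inequality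
`jbracket_sub_le`; the other half remains. -/
theorem jbracket_rpow_mul_le_sub {n : ℕ} {s : ℝ} (hs : 0 ≤ s) (X Y : EuclideanSpace ℝ (Fin n)) :
    jbracket X ^ (-(2 * s)) * jbracket Y ^ (-(2 * s)) ≤
      2 ^ s * (jbracket (X - Y) ^ (-s) * jbracket Y ^ (-s)) := by
  have hX := jbracket_pos X
  have hY := jbracket_pos Y
  have h1 : (2 * (jbracket X * jbracket Y)) ^ (-s) ≤ jbracket (X - Y) ^ (-s) :=
    Real.rpow_le_rpow_of_nonpos (jbracket_pos _) (jbracket_sub_le X Y) (by linarith)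
  rw [Real.mul_rpow (by norm_num) (by positivity), Real.mul_rpow hX.le hY.le,
    Real.rpow_neg (by norm_num), inv_mul_le_iff₀ (by positivity)] at h1
  have h2 : jbracket X ^ (-(2 * s)) ≤ jbracket X ^ (-s) :=
    Real.rpow_le_rpow_of_exponent_le (one_le_jbracket X) (by linarith)
  have h3 : jbracket Y ^ (-(2 * s)) = jbracket Y ^ (-s) * jbracket Y ^ (-s) := by
    rw [← Real.rpow_add hY]
    ring_nf
  rw [h3, ← mul_assoc, ← mul_assoc]
  refine mul_le_mul_of_nonneg_right ?_ (by positivity)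
  exact (mul_le_mul_of_nonneg_right h2 (by positivity)).trans h1

theorem jbracket_le_three_mul_max {n : ℕ} {K K₁ K₂ K₃ : EuclideanSpace ℝ (Fin n)}
    (h : momentum3 K K₁ K₂ K₃ = 0) {M : ℝ} (h1 : jbracket K₁ ≤ M) (h2 : jbracket K₂ ≤ M)
    (h3 : jbracket K₃ ≤ M) : jbracket K ≤ 3 * M := by
  have hM : 0 < M := (jbracket_pos K₁).trans_le h1
  have hsq : ∀ J : EuclideanSpace ℝ (Fin n), jbracket J ≤ M → 1 + ‖J‖ ^ 2 ≤ M ^ 2 := fun J hJ => by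
    rw [← jbracket_sq]
    have := jbracket_pos J
    gcongr
  refine le_of_sq_le_sq ?_ (by positivity)
  rw [jbracket_sq]
  have hK : K = K₁ - K₂ + K₃ := (sub_eq_zero.1 h).symm
  have hn : ‖K‖ ≤ ‖K₁‖ + ‖K₂‖ + ‖K₃‖ := by
    rw [hK]
    exact (norm_add_le _ _).trans (by gcongr; exact norm_sub_le _ _)
  have hn2 : ‖K‖ ^ 2 ≤ (‖K₁‖ + ‖K₂‖ + ‖K₃‖) ^ 2 := by gcongr
  nlinarith [hsq K₁ h1, hsq K₂ h2, hsq K₃ h3, sq_nonneg (‖K₁‖ - ‖K₂‖), sq_nonneg (‖K₁‖ - ‖K₃‖),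
    sq_nonneg (‖K₂‖ - ‖K₃‖)]

/-- Absorbing `⟨K⟩^ℓ` into the largest of the three brackets. -/
theorem jbracket_rpow_mul_le {n : ℕ} {s : ℝ} (hs : 0 ≤ s)
    {K K₁ K₂ K₃ : EuclideanSpace ℝ (Fin n)} (h : momentum3 K K₁ K₂ K₃ = 0) :
    jbracket K ^ (2 * s) * (jbracket K₁ ^ (-(2 * s)) * jbracket K₂ ^ (-(2 * s)) *
      jbracket K₃ ^ (-(2 * s))) ≤
    3 ^ (2 * s) * 2 ^ s * (jbracket (K₁ - K) ^ (-s) * jbracket K₃ ^ (-s) +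
      jbracket K₁ ^ (-s) * jbracket K₃ ^ (-s) + jbracket K₁ ^ (-s) * jbracket (K₃ - K) ^ (-s)) := by
  have hpos : ∀ (J : EuclideanSpace ℝ (Fin n)) (u : ℝ), 0 < jbracket J ^ u :=
    fun J u => Real.rpow_pos_of_pos (jbracket_pos J) u
  have habs : ∀ J : EuclideanSpace ℝ (Fin n), jbracket K₁ ≤ jbracket J → jbracket K₂ ≤ jbracket J →
      jbracket K₃ ≤ jbracket J → jbracket K ^ (2 * s) * jbracket J ^ (-(2 * s)) ≤ 3 ^ (2 * s) := by
    intro J h1 h2 h3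
    rw [Real.rpow_neg (jbracket_pos J).le, ← div_eq_mul_inv, div_le_iff₀ (hpos J _),
      ← Real.mul_rpow (by norm_num) (jbracket_pos J).le]
    exact Real.rpow_le_rpow (jbracket_pos K).le (jbracket_le_three_mul_max h h1 h2 h3)
      (by linarith)
  -- K₂ is not one of the two summation variables. These identities trade its decay for decay in K₁
  -- - K or K₃ - K.
  have hX : K₂ - K₃ = K₁ - K := by
    have := sub_eq_zero.1 h
    rw [← this]
    abel
  have hY : K₂ - K₁ = K₃ - K := by
    have := sub_eq_zero.1 h
    rw [← this]
    abel
  have b1 : jbracket K₂ ^ (-(2 * s)) * jbracket K₃ ^ (-(2 * s)) ≤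
      2 ^ s * (jbracket (K₁ - K) ^ (-s) * jbracket K₃ ^ (-s)) :=
    hX ▸ jbracket_rpow_mul_le_sub hs K₂ K₃
  have b3 : jbracket K₂ ^ (-(2 * s)) * jbracket K₁ ^ (-(2 * s)) ≤
      2 ^ s * (jbracket K₁ ^ (-s) * jbracket (K₃ - K) ^ (-s)) := by
    rw [mul_comm (jbracket K₁ ^ (-s))]
    exact hY ▸ jbracket_rpow_mul_le_sub hs K₂ K₁
  have b2 : jbracket K₁ ^ (-(2 * s)) * jbracket K₃ ^ (-(2 * s)) ≤
      2 ^ s * (jbracket K₁ ^ (-s) * jbracket K₃ ^ (-s)) := by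
    have e : ∀ J : EuclideanSpace ℝ (Fin n), jbracket J ^ (-(2 * s)) ≤ jbracket J ^ (-s) :=
      fun J => Real.rpow_le_rpow_of_exponent_le (one_le_jbracket J) (by linarith)
    have h2s : (1 : ℝ) ≤ 2 ^ s := Real.one_le_rpow (by norm_num) hs
    calc _ ≤ jbracket K₁ ^ (-s) * jbracket K₃ ^ (-s) :=
          mul_le_mul (e _) (e _) (hpos _ _).le (hpos _ _).le
      _ ≤ _ := le_mul_of_one_le_left (mul_pos (hpos _ _) (hpos _ _)).le h2s
  have p1 := mul_pos (hpos (K₁ - K) (-s)) (hpos K₃ (-s))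
  have p2 := mul_pos (hpos K₁ (-s)) (hpos K₃ (-s))
  have p3 := mul_pos (hpos K₁ (-s)) (hpos (K₃ - K) (-s))
  have hT : (0 : ℝ) < 3 ^ (2 * s) * 2 ^ s := by positivity
  have hmax : (jbracket K₂ ≤ jbracket K₁ ∧ jbracket K₃ ≤ jbracket K₁) ∨
      (jbracket K₁ ≤ jbracket K₂ ∧ jbracket K₃ ≤ jbracket K₂) ∨
      (jbracket K₁ ≤ jbracket K₃ ∧ jbracket K₂ ≤ jbracket K₃) := by
    grind
  rcases hmax with ⟨h2, h3⟩ | ⟨h1, h3⟩ | ⟨h1, h2⟩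
  · calc _ = (jbracket K ^ (2 * s) * jbracket K₁ ^ (-(2 * s))) *
          (jbracket K₂ ^ (-(2 * s)) * jbracket K₃ ^ (-(2 * s))) := by ring
      _ ≤ 3 ^ (2 * s) * (2 ^ s * (jbracket (K₁ - K) ^ (-s) * jbracket K₃ ^ (-s))) :=
          mul_le_mul (habs K₁ le_rfl h2 h3) b1 (mul_pos (hpos _ _) (hpos _ _)).le (by positivity)
      _ ≤ _ := by
          rw [← mul_assoc]
          exact mul_le_mul_of_nonneg_left (by linarith) hT.le
  · calc _ = (jbracket K ^ (2 * s) * jbracket K₂ ^ (-(2 * s))) *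
          (jbracket K₁ ^ (-(2 * s)) * jbracket K₃ ^ (-(2 * s))) := by ring
      _ ≤ 3 ^ (2 * s) * (2 ^ s * (jbracket K₁ ^ (-s) * jbracket K₃ ^ (-s))) :=
          mul_le_mul (habs K₂ h1 le_rfl h3) b2 (mul_pos (hpos _ _) (hpos _ _)).le (by positivity)
      _ ≤ _ := by
          rw [← mul_assoc]
          exact mul_le_mul_of_nonneg_left (by linarith) hT.le
  · calc _ = (jbracket K ^ (2 * s) * jbracket K₃ ^ (-(2 * s))) *
          (jbracket K₂ ^ (-(2 * s)) * jbracket K₁ ^ (-(2 * s))) := by ring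
      _ ≤ 3 ^ (2 * s) * (2 ^ s * (jbracket K₁ ^ (-s) * jbracket (K₃ - K) ^ (-s))) :=
          mul_le_mul (habs K₃ h1 h2 le_rfl) b3 (mul_pos (hpos _ _) (hpos _ _)).le (by positivity)
      _ ≤ _ := by
          rw [← mul_assoc]
          exact mul_le_mul_of_nonneg_left (by linarith) hT.le

/-! ### Reduction of the resonant sum to inner products. -/

/-- Expand |K+X|² - |K+X+Y|² + |K+Y|² - |K|²: only the cross term survives. -/
theorem resonance3_eq {n : ℕ} {K K₁ K₂ K₃ : EuclideanSpace ℝ (Fin n)}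
    (h : momentum3 K K₁ K₂ K₃ = 0) :
    resonance3 K K₁ K₂ K₃ = -2 * ∑ i, (K₁ i - K i) * (K₃ i - K i) := by
  have hK : ∀ i, K₂ i = K₁ i + K₃ i - K i := fun i => by
    have := congrArg (fun v : EuclideanSpace ℝ (Fin n) => v i) h
    simp only [momentum3, PiLp.sub_apply, PiLp.add_apply, PiLp.zero_apply] at this
    linarith
  simp only [resonance3, EuclideanSpace.real_norm_sq_eq]
  rw [← Finset.sum_sub_distrib, ← Finset.sum_add_distrib, ← Finset.sum_sub_distrib, Finset.mul_sum]
  refine Finset.sum_congr rfl (fun i _ => ?_)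
  rw [hK]
  ring

/-- The uniform bound for the sums of brackets over finite parts of the resonant set. -/
theorem exists_sum_jbracket_le (k : ℕ) {s : ℝ} (hs : (k + 2 : ℕ) < s) : ∃ C : ℝ, 0 ≤ C ∧
    ∀ L : ℝ, 2 ≤ L → ∀ (K : scaledLattice (k + 2) L) (μ : ℝ) (T : Finset (resonantSet μ K)),
    ∑ p ∈ T, jbracket (K : EuclideanSpace ℝ (Fin (k + 2))) ^ (2 * s) *
      (jbracket (p.1.1 : EuclideanSpace ℝ (Fin (k + 2))) ^ (-(2 * s)) *
        jbracket (p.1.2.1 : EuclideanSpace ℝ (Fin (k + 2))) ^ (-(2 * s)) *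
        jbracket (p.1.2.2 : EuclideanSpace ℝ (Fin (k + 2))) ^ (-(2 * s))) ≤
      C * resonantRate (k + 2) L := by
  have hn : (0 : ℝ) < (k + 2 : ℕ) := by positivity
  have hs0 : 0 < s := hn.trans hs
  -- Chosen so that 2nt = s with n = k + 2; then s > n means t > 1/2, the threshold for summability
  -- on a line.
  set t : ℝ := s / (2 * (k + 2 : ℕ)) with htdef
  have hst : -s = -(2 * ((k + 2 : ℕ) * t)) := by
    rw [htdef]
    field_simp
  have ht : 1 / 2 < t := by
    rw [htdef, lt_div_iff₀ (by positivity)]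
    linarith
  obtain ⟨C, hC, hsum⟩ := exists_sum_boxWeight_le k ht
  refine ⟨3 ^ (2 * s) * 2 ^ s * (C + C + C), by positivity, fun L hL K μ T => ?_⟩
  have hL0 : L ≠ 0 := by linarith
  choose κ hκ using fun J : scaledLattice (k + 2) L => J.2
  have hκinj : Function.Injective κ := by
    intro J J' h
    refine Subtype.ext (PiLp.ext fun i => ?_)
    rw [hκ, hκ, h]
  set Φ : resonantSet μ K → (Fin (k + 2) → ℤ) × (Fin (k + 2) → ℤ) :=
    fun p => (κ p.1.1 - κ K, κ p.1.2.2 - κ K) with hΦ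
  have hΦinj : Function.Injective Φ := by
    intro p p' h
    have h1 : p.1.1 = p'.1.1 := hκinj (sub_left_injective (congrArg Prod.fst h))
    have h3 : p.1.2.2 = p'.1.2.2 := hκinj (sub_left_injective (congrArg Prod.snd h))
    have h2 : p.1.2.1 = p'.1.2.1 := by
      refine Subtype.ext ?_
      have e := p.2.1
      have e' := p'.2.1
      rw [← h1, ← h3, ← e] at e'
      simpa [momentum3] using e'.symm
    exact Subtype.ext (Prod.ext h1 (Prod.ext h2 h3))
  -- If T has a point, -μL²/2 is an integer and equals its floor; if T is empty, the floor merely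
  -- supplies some integer.
  have hdot : ∀ z ∈ T.image Φ, ∑ i, z.1 i * z.2 i = ⌊-(μ * L ^ 2 / 2)⌋ := by
    intro z hz
    obtain ⟨p, -, rfl⟩ := Finset.mem_image.1 hz
    have e := p.2.2
    rw [resonance3_eq p.2.1] at e
    simp only [hκ] at e
    symm
    rw [Int.floor_eq_iff]
    have : -(μ * L ^ 2 / 2) = ((∑ i, (Φ p).1 i * (Φ p).2 i : ℤ) : ℝ) := by
      rw [← e]
      push_cast
      simp only [hΦ, Pi.sub_apply]
      rw [Finset.mul_sum, Finset.sum_mul, Finset.sum_div, ← Finset.sum_neg_distrib]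
      refine Finset.sum_congr rfl (fun i _ => ?_)
      push_cast
      field_simp
    rw [this]
    constructor <;> linarith
  -- The shifts are 0 for the weights in K₁ - K, K₃ - K, and `κ K` for those in K₁, K₃.
  have key : ∀ q₁ q₂ : Fin (k + 2) → ℤ,
      ∑ p ∈ T, boxWeight t (fun i => (((Φ p).1 i + q₁ i : ℤ) : ℝ) / L) *
        boxWeight t (fun i => (((Φ p).2 i + q₂ i : ℤ) : ℝ) / L) ≤ C * resonantRate (k + 2) L := by
    intro q₁ q₂
    have := hsum L hL q₁ q₂ _ (T.image Φ) hdot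
    rwa [Finset.sum_image hΦinj.injOn] at this
  have hbw : ∀ (J : EuclideanSpace ℝ (Fin (k + 2))) (x : Fin (k + 2) → ℤ),
      (∀ i, J i = x i / L) → jbracket J ^ (-s) ≤ boxWeight t (fun i => (x i : ℝ) / L) := by
    intro J x hJ
    rw [hst]
    refine (jbracket_rpow_le_boxWeight (by linarith) J).trans (le_of_eq ?_)
    simp only [hJ]
  have hpt : ∀ p ∈ T, jbracket (K : EuclideanSpace ℝ (Fin (k + 2))) ^ (2 * s) *
      (jbracket (p.1.1 : EuclideanSpace ℝ (Fin (k + 2))) ^ (-(2 * s)) *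
        jbracket (p.1.2.1 : EuclideanSpace ℝ (Fin (k + 2))) ^ (-(2 * s)) *
        jbracket (p.1.2.2 : EuclideanSpace ℝ (Fin (k + 2))) ^ (-(2 * s))) ≤
      3 ^ (2 * s) * 2 ^ s *
        (boxWeight t (fun i => (((Φ p).1 i + (0 : Fin (k + 2) → ℤ) i : ℤ) : ℝ) / L) *
          boxWeight t (fun i => (((Φ p).2 i + κ K i : ℤ) : ℝ) / L) +
        boxWeight t (fun i => (((Φ p).1 i + κ K i : ℤ) : ℝ) / L) *
          boxWeight t (fun i => (((Φ p).2 i + κ K i : ℤ) : ℝ) / L) +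
        boxWeight t (fun i => (((Φ p).1 i + κ K i : ℤ) : ℝ) / L) *
          boxWeight t (fun i => (((Φ p).2 i + (0 : Fin (k + 2) → ℤ) i : ℤ) : ℝ) / L)) := by
    intro p _
    refine (jbracket_rpow_mul_le hs0.le p.2.1).trans ?_
    have hJ : ∀ J : EuclideanSpace ℝ (Fin (k + 2)), 0 ≤ jbracket J ^ (-s) :=
      fun J => (Real.rpow_pos_of_pos (jbracket_pos J) _).le
    have d1 := hbw ((p.1.1 : EuclideanSpace ℝ (Fin (k + 2))) - K)
      (fun i => (Φ p).1 i + (0 : Fin (k + 2) → ℤ) i) (fun i => by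
        simp only [PiLp.sub_apply, hκ, hΦ, Pi.sub_apply, Pi.zero_apply]
        push_cast
        ring)
    have d2 := hbw (p.1.1 : EuclideanSpace ℝ (Fin (k + 2)))
      (fun i => (Φ p).1 i + κ K i) (fun i => by simp [hκ, hΦ])
    have d3 := hbw (p.1.2.2 : EuclideanSpace ℝ (Fin (k + 2)))
      (fun i => (Φ p).2 i + κ K i) (fun i => by simp [hκ, hΦ])
    have d4 := hbw ((p.1.2.2 : EuclideanSpace ℝ (Fin (k + 2))) - K)
      (fun i => (Φ p).2 i + (0 : Fin (k + 2) → ℤ) i) (fun i => by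
        simp only [PiLp.sub_apply, hκ, hΦ, Pi.sub_apply, Pi.zero_apply]
        push_cast
        ring)
    refine mul_le_mul_of_nonneg_left ?_ (by positivity)
    exact add_le_add (add_le_add (mul_le_mul d1 d3 (hJ _) (boxWeight_nonneg _ _))
      (mul_le_mul d2 d3 (hJ _) (boxWeight_nonneg _ _)))
      (mul_le_mul d2 d4 (hJ _) (boxWeight_nonneg _ _))
  refine (Finset.sum_le_sum hpt).trans ?_
  rw [← Finset.mul_sum, Finset.sum_add_distrib, Finset.sum_add_distrib,
    mul_assoc (3 ^ (2 * s) * 2 ^ s) (C + C + C), add_mul, add_mul]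
  refine mul_le_mul_of_nonneg_left ?_ (by positivity)
  exact add_le_add (add_le_add (key _ _) (key _ _)) (key _ _)

/-! ### Absolute convergence and the final bound. -/

theorem mainTheorem4 (n : ℕ) (hn : 2 ≤ n) (ℓ : ℝ) (hℓ : 3 * (n : ℝ) + 2 < ℓ) (A : ℝ) :
    ∃ C : ℝ, ∀ L : ℝ, 2 ≤ L → ∀ a b c : scaledLattice n L → ℂ,
      (∀ K : scaledLattice n L,
        ‖a K‖ + ‖b K‖ + ‖c K‖ ≤ A * jbracket (K : EuclideanSpace ℝ (Fin n)) ^ (-ℓ)) →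
      ∀ (K : scaledLattice n L) (μ : ℝ),
        Summable (fun p : resonantSet μ K => a p.1.1 * b p.1.2.1 * c p.1.2.2) ∧
        jbracket (K : EuclideanSpace ℝ (Fin n)) ^ ℓ *
            ‖∑' p : resonantSet μ K, a p.1.1 * b p.1.2.1 * c p.1.2.2‖ ≤
          C * resonantRate n L := by
  obtain ⟨k, rfl⟩ := Nat.exists_eq_add_of_le' hn
  have hs : ((k + 2 : ℕ) : ℝ) < ℓ / 2 := by
    have : (0 : ℝ) < (k + 2 : ℕ) := by positivity
    linarith
  obtain ⟨C, hC, hsum⟩ := exists_sum_jbracket_le k hs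
  rw [show 2 * (ℓ / 2) = ℓ by ring] at hsum
  refine ⟨A ^ 3 * C, fun L hL a b c habc K μ => ?_⟩
  have hpos : ∀ (J : EuclideanSpace ℝ (Fin (k + 2))) (u : ℝ), 0 < jbracket J ^ u :=
    fun J u => Real.rpow_pos_of_pos (jbracket_pos J) u
  have hA : 0 ≤ A := by
    have h1 : 0 ≤ A * jbracket (K : EuclideanSpace ℝ (Fin (k + 2))) ^ (-ℓ) :=
      le_trans (by positivity) (habc K)
    exact nonneg_of_mul_nonneg_left h1 (hpos _ _)
  have ha : ∀ J, ‖a J‖ ≤ A * jbracket (J : EuclideanSpace ℝ (Fin (k + 2))) ^ (-ℓ) := fun J => by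
    linarith [habc J, norm_nonneg (b J), norm_nonneg (c J)]
  have hb : ∀ J, ‖b J‖ ≤ A * jbracket (J : EuclideanSpace ℝ (Fin (k + 2))) ^ (-ℓ) := fun J => by
    linarith [habc J, norm_nonneg (a J), norm_nonneg (c J)]
  have hc : ∀ J, ‖c J‖ ≤ A * jbracket (J : EuclideanSpace ℝ (Fin (k + 2))) ^ (-ℓ) := fun J => by
    linarith [habc J, norm_nonneg (a J), norm_nonneg (b J)]
  -- A bound for all finite partial sums of norms yields both summability and the estimate.
  have hfin : ∀ T : Finset (resonantSet μ K),
      ∑ p ∈ T, ‖a p.1.1 * b p.1.2.1 * c p.1.2.2‖ ≤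
        A ^ 3 * C * resonantRate (k + 2) L / jbracket (K : EuclideanSpace ℝ (Fin (k + 2))) ^ ℓ := by
    intro T
    rw [le_div_iff₀ (hpos _ _), Finset.sum_mul, mul_assoc]
    refine le_trans ?_ (mul_le_mul_of_nonneg_left (hsum L hL K μ T) (by positivity))
    rw [Finset.mul_sum]
    refine Finset.sum_le_sum (fun p _ => ?_)
    have hprod : ‖a p.1.1 * b p.1.2.1 * c p.1.2.2‖ ≤
        A * jbracket (p.1.1 : EuclideanSpace ℝ (Fin (k + 2))) ^ (-ℓ) *
          (A * jbracket (p.1.2.1 : EuclideanSpace ℝ (Fin (k + 2))) ^ (-ℓ)) *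
          (A * jbracket (p.1.2.2 : EuclideanSpace ℝ (Fin (k + 2))) ^ (-ℓ)) := by
      rw [norm_mul, norm_mul]
      exact mul_le_mul (mul_le_mul (ha p.1.1) (hb p.1.2.1) (norm_nonneg _)
        (mul_nonneg hA (hpos _ _).le)) (hc p.1.2.2) (norm_nonneg _)
        (mul_nonneg (mul_nonneg hA (hpos _ _).le) (mul_nonneg hA (hpos _ _).le))
    refine (mul_le_mul_of_nonneg_right hprod (hpos _ _).le).trans (le_of_eq ?_)
    ring
  have hsummable : Summable (fun p : resonantSet μ K => ‖a p.1.1 * b p.1.2.1 * c p.1.2.2‖) :=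
    summable_of_sum_le (fun _ => norm_nonneg _) hfin
  refine ⟨hsummable.of_norm, ?_⟩
  rw [← le_div_iff₀' (hpos _ _)]
  exact (norm_tsum_le_tsum_norm hsummable).trans
    (Real.tsum_le_of_sum_le (fun _ => norm_nonneg _) hfin)
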